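/- Let $N\in\mathbb N$, let $J$ be a real $2N\times 2N$ matrix with $J^T=J^{-1}=-J$, and let $H:\mathbb R\times\mathbb R^{2N}\times\mathbb R\to\mathbb R$, $(t,\xi,\lambda)\mapsto H(t,\xi,\lambda)$. Call a map $f:\mathbb R\times\mathbb R^M\to\mathbb R^m$ a $C^0$-bundle map if it is continuous and the family $\{f(t,\cdot)\}_{t\in\mathbb R}$ is equicontinuous at every point of $\mathbb R^M$, and a $C^1_\xi$-bundle map if $f$ and its first-order partial derivatives in $\xi\in\mathbb R^M$ (which exist) are $C^0$-bundle maps. Assume: (H1) $H$ is continuous, $H(t,\cdot,\lambda)\in C^2(\mathbb R^{2N})$ and $D_\xi H(t,0,\lambda)=0$ for all $t,\lambda\in\mathbb R$. (H2) The derivatives $D_\xi H$, $D_\xi^2H$, $D_\lambda D_\xi H$, $D_\lambda D_\xi^2H$ and $D_\xi D_\lambda D_\xi H$ exist and are continuous on $\mathbb R\times\mathbb R^{2N}\times\mathbb R$. (H3) For each $\lambda$, $D_\xi H(\cdot,\cdot,\lambda)$ is a $C^1_\xi$-bundle map, and $D_\lambda D_\xi^2H:\mathbb R\times(\mathbb R^{2N}\times\mathbb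 R)\to\mathbb R^{2N\times 2N}$ is a $C^0$-bundle map (equicontinuity in $(\xi,\lambda)$). (H4) $D_\xi^2H(\cdot,0,0)$ and $D_\lambda D_\xi^2H(\cdot,0,0)$ belong to $L^\infty(\mathbb R)$. (H$^\infty$) For every $\lambda\in\mathbb R$ there are $C^1_\xi$-bundle maps $g^\pm(\cdot,\cdot,\lambda):\mathbb R\times\mathbb R^{2N}\to\mathbb R^{2N}$ and numbers $T^\pm=T^\pm(\lambda)>0$ such that $g^\pm(t,0,\lambda)=0$ and $g^\pm(t+T^\pm,\xi,\lambda)=g^\pm(t,\xi,\lambda)$ for all $t,\xi$, and $$\lim_{t\to\pm\infty}\{D_\xi^2H(t,\xi,\lambda)-D_\xi g^\pm(t,\xi,\lambda)\}=0$$ uniformly for $\xi$ in bounded subsets of $\mathbb R^{2N}$. Let $\lambda\in\mathbb R$, put $A_\lambda^\pm(t)=D_\xi g^\pm(t,0,\lambda)$, and assume that neither of the periodic linear systems $Ju'-A_\lambda^+(t)u=0$ and $Ju'-A_\lambda^-(t)u=0$ has a characteristic multiplier on the unit circle; here the characteristic multipliers are the complex eigenvalues of the monodromy matrix $\Phi^\pm(T^\pm)$,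 where $\Phi^\pm$ is the fundamental matrix of the system with $\Phi^\pm(0)=I$. If $x:\mathbb R\to\mathbb R^{2N}$ is differentiable and satisfies $$Jx'(t)=D_\xi H(t,x(t),\lambda)\quad(t\in\mathbb R),\qquad \lim_{t\to-\infty}x(t)=\lim_{t\to+\infty}x(t)=0,$$ then there is a constant $\gamma>0$ such that $\lim_{|t|\to\infty}e^{\gamma|t|}\,|x(t)|=0$. -/

import Mathlib

open Filter Topology MeasureTheory

/-- The phase space `ℝ^{2N}` with its Euclidean norm. -/
abbrev Phase (N : ℕ) : Type := EuclideanSpace ℝ (Fin (2 * N))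

/-- The linear map `ξ ↦ Jξ` of `ℝ^{2N}` given by a real `2N × 2N` matrix `J`. -/
noncomputable abbrev matAct {N : ℕ} (J : Matrix (Fin (2 * N)) (Fin (2 * N)) ℝ) :
    Phase N →L[ℝ] Phase N :=
  Matrix.toEuclideanCLM (𝕜 := ℝ) J

/-- `Jᵀ = J⁻¹ = -J`; invertibility is expressed by `J * Jᵀ = 1`. -/
def IsSymplecticUnit {N : ℕ} (J : Matrix (Fin (2 * N)) (Fin (2 * N)) ℝ) : Prop :=
  J.transpose = -J ∧ J * J.transpose = 1

section BundleMaps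

/-- `f` is an equicontinuous `C⁰`-bundle map: `f` is jointly continuous and the family
`{f(t, ·)}` indexed by `t ∈ ℝ` is equicontinuous at every point. -/
def IsBundleMapC0 {X F : Type*} [TopologicalSpace X] [UniformSpace F] (f : ℝ → X → F) : Prop :=
  Continuous (fun p : ℝ × X => f p.1 p.2) ∧ Equicontinuous f

/-- `f` is an equicontinuous `C¹`-bundle map: `f` and its first derivative in the second
variable (which exists) are equicontinuous `C⁰`-bundle maps. -/
def IsBundleMapC1 {X F : Type*} [NormedAddCommGroup X] [NormedSpace ℝ X]
    [NormedAddCommGroup F] [NormedSpace ℝ F] (f : ℝ → X → F) : Prop :=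
  IsBundleMapC0 f ∧ (∀ t, Differentiable ℝ (f t)) ∧ IsBundleMapC0 (fun t ξ => fderiv ℝ (f t) ξ)

end BundleMaps

section Hamiltonian

/-- `D_ξ H(t, ξ, λ)`, the gradient of `H` in `ξ`. -/
noncomputable def gradH {N : ℕ} (H : ℝ → Phase N → ℝ → ℝ) (t : ℝ) (ξ : Phase N) (lam : ℝ) :
    Phase N :=
  gradient (fun η => H t η lam) ξ

/-- `D_ξ² H(t, ξ, λ)`, the Hessian of `H` in `ξ` as a linear map of `ℝ^{2N}`. -/
noncomputable def hessH {N : ℕ} (H : ℝ → Phase N → ℝ → ℝ) (t : ℝ) (ξ : Phase N) (lam : ℝ) :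
    Phase N →L[ℝ] Phase N :=
  fderiv ℝ (fun η => gradH H t η lam) ξ

/-- `D_λ D_ξ H(t, ξ, λ)`. -/
noncomputable def dlamGradH {N : ℕ} (H : ℝ → Phase N → ℝ → ℝ) (t : ℝ) (ξ : Phase N) (lam : ℝ) :
    Phase N :=
  deriv (fun l => gradH H t ξ l) lam

/-- `D_λ D_ξ² H(t, ξ, λ)`. -/
noncomputable def dlamHessH {N : ℕ} (H : ℝ → Phase N → ℝ → ℝ) (t : ℝ) (ξ : Phase N) (lam : ℝ) :
    Phase N →L[ℝ] Phase N :=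
  deriv (fun l => hessH H t ξ l) lam

/-- `D_ξ D_λ D_ξ H(t, ξ, λ)`. -/
noncomputable def dxiDlamGradH {N : ℕ} (H : ℝ → Phase N → ℝ → ℝ) (t : ℝ) (ξ : Phase N)
    (lam : ℝ) : Phase N →L[ℝ] Phase N :=
  fderiv ℝ (fun η => dlamGradH H t η lam) ξ

/-- (H1): `H` is continuous, `H(t, ·, λ)` is `C²` and `D_ξ H(t, 0, λ) = 0`. -/
structure HypH1 {N : ℕ} (H : ℝ → Phase N → ℝ → ℝ) : Prop where
  continuous : Continuous (fun p : ℝ × Phase N × ℝ => H p.1 p.2.1 p.2.2)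
  contDiff : ∀ t lam, ContDiff ℝ 2 (fun ξ => H t ξ lam)
  grad_zero : ∀ t lam, gradH H t 0 lam = 0

/-- (H2): the derivatives `D_ξ H`, `D_ξ² H`, `D_λ D_ξ H`, `D_λ D_ξ² H`, `D_ξ D_λ D_ξ H` exist
and are continuous in `(t, ξ, λ)`. -/
structure HypH2 {N : ℕ} (H : ℝ → Phase N → ℝ → ℝ) : Prop where
  grad_exists : ∀ t lam, Differentiable ℝ (fun ξ => H t ξ lam)
  hess_exists : ∀ t lam, Differentiable ℝ (fun ξ => gradH H t ξ lam)
  dlamGrad_exists : ∀ t ξ, Differentiable ℝ (fun lam => gradH H t ξ lam)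
  dlamHess_exists : ∀ t ξ, Differentiable ℝ (fun lam => hessH H t ξ lam)
  dxiDlamGrad_exists : ∀ t lam, Differentiable ℝ (fun ξ => dlamGradH H t ξ lam)
  grad_cont : Continuous (fun p : ℝ × Phase N × ℝ => gradH H p.1 p.2.1 p.2.2)
  hess_cont : Continuous (fun p : ℝ × Phase N × ℝ => hessH H p.1 p.2.1 p.2.2)
  dlamGrad_cont : Continuous (fun p : ℝ × Phase N × ℝ => dlamGradH H p.1 p.2.1 p.2.2)
  dlamHess_cont : Continuous (fun p : ℝ × Phase N × ℝ => dlamHessH H p.1 p.2.1 p.2.2)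
  dxiDlamGrad_cont : Continuous (fun p : ℝ × Phase N × ℝ => dxiDlamGradH H p.1 p.2.1 p.2.2)

/-- (H3): `D_ξ H(·, ·, λ)` is a `C¹`-bundle map in `ξ` for each `λ`, and `D_λ D_ξ² H` is a
`C⁰`-bundle map in `(ξ, λ)`. -/
structure HypH3 {N : ℕ} (H : ℝ → Phase N → ℝ → ℝ) : Prop where
  grad_bundle : ∀ lam, IsBundleMapC1 (fun t ξ => gradH H t ξ lam)
  dlamHess_bundle : IsBundleMapC0 (fun t (p : Phase N × ℝ) => dlamHessH H t p.1 p.2)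

/-- (H4): `D_ξ² H(·, 0, 0)` and `D_λ D_ξ² H(·, 0, 0)` belong to `L^∞(ℝ)`. -/
structure HypH4 {N : ℕ} (H : ℝ → Phase N → ℝ → ℝ) : Prop where
  hess_bdd : MemLp (fun t => hessH H t 0 0) ⊤ volume
  dlamHess_bdd : MemLp (fun t => dlamHessH H t 0 0) ⊤ volume

/-- (H^∞): for every `λ`, `H` is asymptotically periodic in `t`, with limits
`g⁺ = gp`, `g⁻ = gm` and periods `T⁺ = Tp λ`, `T⁻ = Tm λ`. -/
structure HypHInf {N : ℕ} (H : ℝ → Phase N → ℝ → ℝ) (gp gm : ℝ → Phase N → ℝ → Phase N)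
    (Tp Tm : ℝ → ℝ) : Prop where
  bundle_p : ∀ lam, IsBundleMapC1 (fun t ξ => gp t ξ lam)
  bundle_m : ∀ lam, IsBundleMapC1 (fun t ξ => gm t ξ lam)
  zero_p : ∀ t lam, gp t 0 lam = 0
  zero_m : ∀ t lam, gm t 0 lam = 0
  lim_p : ∀ lam, ∀ B : Set (Phase N), Bornology.IsBounded B →
    TendstoUniformlyOn (fun t ξ => hessH H t ξ lam - fderiv ℝ (fun η => gp t η lam) ξ)
      (fun _ => 0) atTop B
  lim_m : ∀ lam, ∀ B : Set (Phase N), Bornology.IsBounded B →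
    TendstoUniformlyOn (fun t ξ => hessH H t ξ lam - fderiv ℝ (fun η => gm t η lam) ξ)
      (fun _ => 0) atBot B
  period_p_pos : ∀ lam, 0 < Tp lam
  period_m_pos : ∀ lam, 0 < Tm lam
  periodic_p : ∀ t ξ lam, gp (t + Tp lam) ξ lam = gp t ξ lam
  periodic_m : ∀ t ξ lam, gm (t + Tm lam) ξ lam = gm t ξ lam

/-- `x` is a solution of the system `J x'(t) = ∇H(t, x(t), λ)` on `ℝ`
with `x(t) → 0` as `t → -∞` and as `t → +∞`. -/
structure IsHomoclinicSolution {N : ℕ} (J : Matrix (Fin (2 * N)) (Fin (2 * N)) ℝ)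
    (H : ℝ → Phase N → ℝ → ℝ) (lam : ℝ) (x : ℝ → Phase N) : Prop where
  differentiable : Differentiable ℝ x
  equation : ∀ t, matAct J (deriv x t) = gradH H t (x t) lam
  lim_atBot : Tendsto x atBot (𝓝 0)
  lim_atTop : Tendsto x atTop (𝓝 0)

end Hamiltonian

section Floquet

/-- `Φ` is the principal fundamental solution (at `t = 0`) of the linear system
`J u' - A(t) u = 0`. -/
structure IsPrincipalFundamental {N : ℕ} (J : Matrix (Fin (2 * N)) (Fin (2 * N)) ℝ)
    (A Φ : ℝ → Phase N →L[ℝ] Phase N) : Prop where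
  initial : Φ 0 = 1
  differentiable : Differentiable ℝ Φ
  equation : ∀ t, matAct J ∘L deriv Φ t = A t ∘L Φ t

/-- The complex number `ρ` is a characteristic multiplier of the `T`-periodic system
`J u' - A(t) u = 0`: an eigenvalue of (the complexification of) the monodromy map `Φ(T)`. -/
def IsCharacteristicMultiplier {N : ℕ} (J : Matrix (Fin (2 * N)) (Fin (2 * N)) ℝ)
    (A : ℝ → Phase N →L[ℝ] Phase N) (T : ℝ) (ρ : ℂ) : Prop :=
  ∃ Φ : ℝ → Phase N →L[ℝ] Phase N, IsPrincipalFundamental J A Φ ∧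
    Module.End.HasEigenvalue
      (LinearMap.baseChange ℂ (Φ T : Phase N →ₗ[ℝ] Phase N)) ρ

/-- The `T`-periodic system `J u' - A(t) u = 0` has no characteristic multipliers on the
unit circle. -/
def NoUnitMultiplier {N : ℕ} (J : Matrix (Fin (2 * N)) (Fin (2 * N)) ℝ)
    (A : ℝ → Phase N →L[ℝ] Phase N) (T : ℝ) : Prop :=
  ∀ ρ : ℂ, IsCharacteristicMultiplier J A T ρ → ‖ρ‖ ≠ 1

/-- `A_λ^±(t) = D_ξ g^±(t, 0, λ)`. -/
noncomputable def asympMatrix {N : ℕ} (g : ℝ → Phase N → ℝ → Phase N) (lam t : ℝ) :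
    Phase N →L[ℝ] Phase N :=
  fderiv ℝ (fun ξ => g t ξ lam) 0

end Floquet

/-! Since `J² = -1`, the equation reads `x' = -J ∇H(t, x, λ)`. By (H^∞), equicontinuity of `D_ξ g^±`
at `0` and the mean value inequality, the right side is `-J A^±(t) x + o(|x|)` as `t → ±∞` along `x
→ 0` (`eventually_norm_gradH_sub_asympMatrix_le`). So `x` solves a small relative perturbation of a
periodic linear system.

At `+∞`, sample `x` at the times `nT`. By Gronwall, `x((n+1)T)` differs from `Φ(T) x(nT)` by at most
a small multiple of `|x(nT)|`. As the monodromy map `Φ(T)` has no eigenvalue on the unit circle, it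
contracts a seminorm `p` and expands a seminorm `q`, with `p + q` equivalent to the norm
(`exists_hyperbolic_seminorms`). If `p ≤ q` at one sample with `q ≠ 0`, then `q` grows geometrically
from there, which boundedness excludes. Hence `q ≤ p` always, and then `p` contracts at each step
(`norm_le_geometric_of_hyperbolic`). Gronwall fills in the times between samples.

The end `-∞` is the same after time reversal, which replaces the monodromy map by its inverse. The
global `Φ` must be constructed, because the multiplier hypothesis says something only about
fundamental solutions that exist. -/

/-! ### Linear equations in a Banach algebra and the Floquet identity -/

section FundamentalSolution

variable {A : Type*} [NormedRing A] [NormedAlgebra ℝ A] [CompleteSpace A]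

-- The weight `cosh (c t)` is a smooth substitute for `exp (c|t|)`: integrating it gains the factor
-- `1 / c` that makes the weighted Picard operator a contraction.
omit [CompleteSpace A] in
theorem norm_integral_mul_cosh_le {B f : ℝ → A} {K c C : ℝ} (hc : 0 < c)
    (hBK : ∀ t, ‖B t‖ ≤ K) (hf : ∀ t, ‖f t‖ ≤ C) (hK : 0 ≤ K) (t : ℝ) :
    ‖∫ s in (0 : ℝ)..t, Real.cosh (c * s) • (B s * f s)‖ ≤ K * C * (Real.cosh (c * t) / c) := by
  have h1 : ‖∫ s in (0 : ℝ)..t, Real.cosh (c * s) • (B s * f s)‖ ≤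
      |∫ s in (0 : ℝ)..t, K * C * Real.cosh (c * s)| := by
    refine intervalIntegral.norm_integral_le_abs_of_norm_le (Eventually.of_forall fun s => ?_)
      (Continuous.intervalIntegrable (by fun_prop) _ _)
    rw [norm_smul, Real.norm_eq_abs, abs_of_pos (Real.cosh_pos _), mul_comm]
    refine mul_le_mul_of_nonneg_right ((norm_mul_le _ _).trans ?_) (Real.cosh_pos _).le
    exact mul_le_mul (hBK s) (hf s) (norm_nonneg _) hK
  have h2 : ∫ s in (0 : ℝ)..t, Real.cosh (c * s) = Real.sinh (c * t) / c := by
    have hd : ∀ s ∈ Set.uIcc 0 t,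
        HasDerivAt (fun s => Real.sinh (c * s) / c) (Real.cosh (c * s)) s := fun s _ => by
      have := (((hasDerivAt_id s).const_mul c).sinh).div_const c
      simpa [hc.ne'] using this
    rw [intervalIntegral.integral_eq_sub_of_hasDerivAt hd
      (Continuous.intervalIntegrable (by fun_prop) _ _)]
    simp
  have hC : 0 ≤ C := (norm_nonneg _).trans (hf 0)
  refine h1.trans ?_
  rw [intervalIntegral.integral_const_mul, h2, abs_mul, abs_of_nonneg (mul_nonneg hK hC), abs_div,
    abs_of_pos hc]
  refine mul_le_mul_of_nonneg_left ?_ (mul_nonneg hK hC)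
  refine div_le_div_of_nonneg_right ?_ hc.le
  rw [Real.abs_sinh]
  exact (Real.sinh_lt_cosh _).le.trans (Real.cosh_abs _).le

/-- A linear equation `Φ' = B Φ` with bounded continuous coefficient in a Banach algebra has a
global solution with `Φ 0 = 1`. -/
theorem exists_fundamentalSolution {B : ℝ → A} (hB : Continuous B) {K : ℝ}
    (hBK : ∀ t, ‖B t‖ ≤ K) :
    ∃ Φ : ℝ → A, Φ 0 = 1 ∧ ∀ t, HasDerivAt Φ (B t * Φ t) t := by
  have hK : 0 ≤ K := (norm_nonneg _).trans (hBK 0)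
  -- This makes `K / c ≤ 1 / 2`, the contraction constant, and keeps `c` positive when `K = 0`.
  set c : ℝ := 2 * K + 1 with hc_def
  have hc : 0 < c := by positivity
  have hcosh : ∀ t, 1 ≤ Real.cosh (c * t) := fun t => Real.one_le_cosh _
  have hpos : ∀ t, 0 < Real.cosh (c * t) := fun t => Real.cosh_pos _
  have hne : ∀ t, Real.cosh (c * t) ≠ 0 := fun t => (hpos t).ne'
  have hcont : ∀ f : BoundedContinuousFunction ℝ A,
      Continuous fun s => Real.cosh (c * s) • (B s * f s) := fun f => by fun_prop
  have hcont' : ∀ f : BoundedContinuousFunction ℝ A, Continuous fun t =>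
      (Real.cosh (c * t))⁻¹ • (1 + ∫ s in (0 : ℝ)..t, Real.cosh (c * s) • (B s * f s)) := by
    intro f
    refine Continuous.smul (Continuous.inv₀ (by fun_prop) hne) (continuous_const.add ?_)
    exact intervalIntegral.continuous_primitive
      (fun a b => (hcont f).intervalIntegrable a b) 0
  -- The Picard operator conjugated by the weight: if `G f = f`, then `cosh (c t) • f t` solves the
  -- integral equation.
  let G : BoundedContinuousFunction ℝ A → BoundedContinuousFunction ℝ A := fun f =>
    BoundedContinuousFunction.ofNormedAddCommGroup _ (hcont' f)
      (‖(1 : A)‖ + K * ‖f‖ / c) (fun t => by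
        rw [norm_smul, norm_inv, Real.norm_eq_abs, abs_of_pos (hpos t),
          inv_mul_le_iff₀ (hpos t)]
        refine (norm_add_le _ _).trans ?_
        have := norm_integral_mul_cosh_le hc hBK (fun t => f.norm_coe_le_norm t) hK t
        have h1 : ‖(1 : A)‖ ≤ Real.cosh (c * t) * ‖(1 : A)‖ :=
          le_mul_of_one_le_left (norm_nonneg _) (hcosh t)
        calc _ ≤ Real.cosh (c * t) * ‖(1 : A)‖ + K * ‖f‖ * (Real.cosh (c * t) / c) :=
              add_le_add h1 this
          _ = _ := by ring)
  have hG : ContractingWith (1 / 2) G := by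
    refine ⟨by rw [← NNReal.coe_lt_coe]; norm_num, LipschitzWith.of_dist_le_mul fun f g => ?_⟩
    rw [BoundedContinuousFunction.dist_le (by positivity)]
    intro t
    simp only [G, BoundedContinuousFunction.coe_ofNormedAddCommGroup]
    rw [dist_eq_norm, ← smul_sub, add_sub_add_left_eq_sub, ← intervalIntegral.integral_sub
      ((hcont f).intervalIntegrable _ _) ((hcont g).intervalIntegrable _ _)]
    simp only [← smul_sub, ← mul_sub]
    rw [norm_smul, norm_inv, Real.norm_eq_abs, abs_of_pos (hpos t), inv_mul_le_iff₀ (hpos t)]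
    refine (norm_integral_mul_cosh_le hc hBK (f := fun s => f s - g s) (C := dist f g)
      (fun t => ?_) hK t).trans ?_
    · rw [← dist_eq_norm]; exact BoundedContinuousFunction.dist_coe_le_dist t
    · have : K / c ≤ 1 / 2 := by rw [div_le_div_iff₀ hc two_pos]; linarith
      have h2 : K / c * (dist f g * Real.cosh (c * t)) ≤
          1 / 2 * (dist f g * Real.cosh (c * t)) :=
        mul_le_mul_of_nonneg_right this (mul_nonneg dist_nonneg (hpos t).le)
      calc _ = K / c * (dist f g * Real.cosh (c * t)) := by ring
        _ ≤ _ := h2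
        _ = _ := by push_cast; ring
  obtain ⟨f, hf⟩ : ∃ f, G f = f := ⟨_, hG.fixedPoint_isFixedPt⟩
  have hval : ∀ t, Real.cosh (c * t) • f t =
      1 + ∫ s in (0 : ℝ)..t, Real.cosh (c * s) • (B s * f s) := fun t => by
    conv_lhs => rw [← hf]
    simp only [G, BoundedContinuousFunction.coe_ofNormedAddCommGroup]
    rw [smul_inv_smul₀ (hne t)]
  refine ⟨fun t => Real.cosh (c * t) • f t, by simpa using hval 0, fun t => ?_⟩
  have hd := (((hcont f).integral_hasStrictDerivAt 0 t).hasDerivAt).const_add (1 : A)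
  simp only [← hval] at hd
  simpa [mul_smul_comm] using hd

omit [CompleteSpace A] in
/-- The Floquet identity for the fundamental solution of a periodic linear equation. -/
theorem fundamentalSolution_add_period {B Φ : ℝ → A} {K T : ℝ}
    (hBK : ∀ t, ‖B t‖ ≤ K) (hper : Function.Periodic B T)
    (h0 : Φ 0 = 1) (hΦ : ∀ t, HasDerivAt Φ (B t * Φ t) t) (t : ℝ) :
    Φ (t + T) = Φ t * Φ T := by
  have hlip : ∀ t, LipschitzOnWith K.toNNReal (fun X : A => B t * X) Set.univ := fun t =>
    (LipschitzWith.of_dist_le_mul fun X Y => by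
      rw [dist_eq_norm, dist_eq_norm, ← mul_sub]
      exact (norm_mul_le _ _).trans (mul_le_mul_of_nonneg_right
        ((hBK t).trans (Real.le_coe_toNNReal K)) (norm_nonneg _))).lipschitzOnWith
  -- Both sides solve `X' = B X` with value `Φ T` at `0`. The sign of `T` plays no role.
  have h1 : ∀ t, HasDerivAt (fun t => Φ (t + T)) (B t * Φ (t + T)) t := fun t => by
    have := (hΦ (t + T)).comp_add_const t T
    rwa [hper] at this
  have h2 : ∀ t, HasDerivAt (fun t => Φ t * Φ T) (B t * (Φ t * Φ T)) t := fun t => by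
    rw [← mul_assoc]
    exact (hΦ t).mul_const _
  have := ODE_solution_unique_univ (t₀ := 0) hlip (fun t => ⟨h1 t, Set.mem_univ _⟩)
    (fun t => ⟨h2 t, Set.mem_univ _⟩) (by simp [h0])
  exact congrFun this t

end FundamentalSolution

/-! ### Contracted and expanded seminorms of a hyperbolic map -/

section HyperbolicSplitting

theorem Seminorm.finsetSum_apply {𝕜 V ι : Type*} [NormedField 𝕜] [AddCommGroup V] [Module 𝕜 V]
    (S : Finset ι) (p : ι → Seminorm 𝕜 V) (v : V) : (∑ i ∈ S, p i) v = ∑ i ∈ S, p i v := by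
  classical
  induction S using Finset.induction_on with
  | empty => simp
  | insert a S h ih => rw [Finset.sum_insert h, Finset.sum_insert h, ← ih]; rfl

/-- On the range of an endomorphism `g` annihilated by a power of `f - μ` there is a seminorm
for which `f` is `δ`-close to multiplication by `μ`. -/
theorem exists_seminorm_of_pow_mul_eq_zero {V : Type*} [AddCommGroup V] [Module ℂ V]
    (r : Seminorm ℂ V) (f g : Module.End ℂ V) (hfg : Commute f g) (μ : ℂ) {δ : ℝ} (hδ : 0 < δ)
    {m : ℕ} (hm : 0 < m) (hg : (f - algebraMap ℂ (Module.End ℂ V) μ) ^ m * g = 0) :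
    ∃ p : Seminorm ℂ V, (∀ v, p (f v) ≤ (‖μ‖ + δ) * p v) ∧ (∀ v, (‖μ‖ - δ) * p v ≤ p (f v)) ∧
      ∀ v, r (g v) ≤ p v := by
  set M : Module.End ℂ V := f - algebraMap ℂ (Module.End ℂ V) μ with hM
  set n : Module.End ℂ V := (δ : ℂ)⁻¹ • M with hn
  have hδ' : (δ : ℂ) ≠ 0 := by exact_mod_cast hδ.ne'
  have hng : Commute n g :=
    (hfg.sub_left (Algebra.commute_algebraMap_left μ g)).smul_left _
  have hnm : n ^ m * g = 0 := by rw [hn, smul_pow, smul_mul_assoc, hg, smul_zero]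
  -- Applying `n` shifts this sum by one place; the new top term vanishes because `n ^ m * g = 0`,
  -- so `p ∘ n ≤ p`. Both estimates then follow from `f = μ + δ n`.
  let p : Seminorm ℂ V := ∑ j ∈ Finset.range m, r.comp (n ^ j * g)
  have hp : ∀ v, p v = ∑ j ∈ Finset.range m, r ((n ^ j * g) v) := fun v => by
    simp [p]
  have hpn : ∀ v, p (n v) ≤ p v := fun v => by
    rw [hp, hp]
    have h1 : ∀ j, r ((n ^ j * g) (n v)) = r ((n ^ (j + 1) * g) v) := fun j => by
      rw [pow_succ, mul_assoc, hng.eq, ← mul_assoc]; rfl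
    have h2 := Finset.sum_range_succ (fun j => r ((n ^ j * g) v)) m
    rw [Finset.sum_range_succ', hnm] at h2
    simp only [h1]
    simp only [LinearMap.zero_apply, map_zero, add_zero] at h2
    have : 0 ≤ r ((n ^ 0 * g) v) := apply_nonneg _ _
    linarith
  have hf : ∀ v, f v = μ • v + (δ : ℂ) • n v := fun v => by
    simp [hn, hM, smul_smul, hδ']
  have hδn : ∀ v, p ((δ : ℂ) • n v) ≤ δ * p v := fun v => by
    rw [map_smul_eq_mul, Complex.norm_real, Real.norm_eq_abs, abs_of_pos hδ]
    exact mul_le_mul_of_nonneg_left (hpn v) hδ.le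
  refine ⟨p, fun v => ?_, fun v => ?_, fun v => ?_⟩
  · rw [hf, add_mul]
    refine (map_add_le_add p _ _).trans (add_le_add ?_ (hδn v))
    rw [map_smul_eq_mul]
  · have h1 : μ • v = f v - (δ : ℂ) • n v := by rw [hf]; abel
    have h2 : p (μ • v) ≤ p (f v) + p ((δ : ℂ) • n v) := h1 ▸ map_sub_le_add p _ _
    rw [map_smul_eq_mul] at h2
    linarith [hδn v]
  · rw [hp]
    have := Finset.single_le_sum (f := fun j => r ((n ^ j * g) v))
      (fun j _ => apply_nonneg r _) (Finset.mem_range.2 hm)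
    simpa using this

open Polynomial in
/-- An endomorphism of a finite-dimensional complex space without eigenvalues on the unit circle
admits a contracted and an expanded seminorm which jointly separate points. -/
theorem exists_hyperbolic_seminorms_complex {V : Type*} [AddCommGroup V] [Module ℂ V]
    [FiniteDimensional ℂ V] (f : Module.End ℂ V) (hf : ∀ ρ : ℂ, f.HasEigenvalue ρ → ‖ρ‖ ≠ 1) :
    ∃ (κ : ℝ) (p q : Seminorm ℂ V), 0 < κ ∧ κ ≤ 1 / 2 ∧ (∀ v, p (f v) ≤ (1 - 2 * κ) * p v) ∧
      (∀ v, (1 + 2 * κ) * q v ≤ q (f v)) ∧ ∀ v, p v = 0 → q v = 0 → v = 0 := by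
  classical
  set b := Module.finBasis ℂ V
  let r : Seminorm ℂ V := (normSeminorm ℂ (Fin (Module.finrank ℂ V) → ℂ)).comp
    (b.equivFun : V →ₗ[ℂ] _)
  have hr : ∀ v, r v = 0 → v = 0 := fun v hv => by simpa [r] using hv
  set S := f.charpoly.roots.toFinset with hS
  -- An exponent at least every root multiplicity; the `+ 1` makes it positive.
  set m : ℕ := f.charpoly.natDegree + 1 with hm
  let s : ℂ → ℂ[X] := fun μ => (X - C μ) ^ m
  have hann : aeval f (∏ μ ∈ S, s μ) = 0 := by
    have h1 : f.charpoly ∣ ∏ μ ∈ S, s μ := by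
      rw [(IsAlgClosed.splits f.charpoly).eq_prod_roots_of_monic f.charpoly_monic,
        Finset.prod_multiset_map_count]
      refine Finset.prod_dvd_prod_of_dvd _ _ fun μ _ => pow_dvd_pow _ ?_
      exact (Multiset.count_le_card _ _).trans ((card_roots' _).trans (Nat.le_succ _))
    obtain ⟨c, hc⟩ := h1
    rw [hc, map_mul, LinearMap.aeval_self_charpoly, zero_mul]
  have hSne : ∀ μ ∈ S, ‖μ‖ ≠ 1 := fun μ hμ => hf μ <| by
    rw [Module.End.hasEigenvalue_iff_isRoot_charpoly]
    exact isRoot_of_mem_roots (Multiset.mem_toFinset.1 hμ)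
  -- At most a third of the gap between spectrum and unit circle: with `δ = κ`, the factors `‖μ‖ +
  -- κ` and `‖μ‖ - κ` still clear `1` by `2κ`.
  obtain ⟨κ, hκ0, hκ2, hκ⟩ : ∃ κ : ℝ, 0 < κ ∧ κ ≤ 1 / 2 ∧ ∀ μ ∈ S, 3 * κ ≤ |‖μ‖ - 1| := by
    clear_value S
    clear hS hann
    induction S using Finset.induction_on with
    | empty => exact ⟨1 / 2, by norm_num, le_rfl, by simp⟩
    | insert a S _ ih =>
      obtain ⟨κ, h0, h2, h⟩ := ih fun μ hμ => hSne μ (Finset.mem_insert_of_mem hμ)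
      have ha : 0 < |‖a‖ - 1| :=
        abs_pos.2 (sub_ne_zero.2 (hSne a (Finset.mem_insert_self _ _)))
      refine ⟨min κ (|‖a‖ - 1| / 3), by positivity, (min_le_left _ _).trans h2, fun μ hμ => ?_⟩
      rcases Finset.mem_insert.1 hμ with rfl | hμ
      · linarith [min_le_right κ (|‖μ‖ - 1| / 3)]
      · linarith [min_le_left κ (|‖a‖ - 1| / 3), h μ hμ]
  let g : ℂ → Module.End ℂ V := fun μ => aeval f (∏ ν ∈ S \ {μ}, s ν)
  have hcomm : ∀ (P : ℂ[X]), Commute f (aeval f P) := fun P => by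
    have := Commute.all (X : ℂ[X]) P
    simpa using this.map (aeval f)
  have hex : ∀ μ ∈ S, ∃ p : Seminorm ℂ V, (∀ v, p (f v) ≤ (‖μ‖ + κ) * p v) ∧
      (∀ v, (‖μ‖ - κ) * p v ≤ p (f v)) ∧ ∀ v, r (g μ v) ≤ p v := fun μ hμ => by
    refine exists_seminorm_of_pow_mul_eq_zero r f (g μ) (hcomm _) μ hκ0 (Nat.succ_pos _ : 0 < m) ?_
    have h1 : (f - algebraMap ℂ (Module.End ℂ V) μ) ^ m = aeval f (s μ) := by simp [s]
    rw [h1, ← map_mul, Finset.sdiff_singleton_eq_erase, Finset.mul_prod_erase _ _ hμ, hann]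
  choose! P hP1 hP2 hP3 using hex
  refine ⟨κ, ∑ μ ∈ S with ‖μ‖ < 1, P μ, ∑ μ ∈ S with ¬ ‖μ‖ < 1, P μ, hκ0, hκ2, fun v => ?_,
    fun v => ?_, fun v hv1 hv2 => ?_⟩
  · simp only [Seminorm.finsetSum_apply, Finset.mul_sum]
    refine Finset.sum_le_sum fun μ hμ => (hP1 μ (Finset.mem_filter.1 hμ).1 v).trans ?_
    refine mul_le_mul_of_nonneg_right ?_ (apply_nonneg _ _)
    have := hκ μ (Finset.mem_filter.1 hμ).1
    rw [abs_of_neg (by linarith [(Finset.mem_filter.1 hμ).2])] at this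
    linarith
  · simp only [Seminorm.finsetSum_apply, Finset.mul_sum]
    refine Finset.sum_le_sum fun μ hμ => le_trans ?_ (hP2 μ (Finset.mem_filter.1 hμ).1 v)
    refine mul_le_mul_of_nonneg_right ?_ (apply_nonneg _ _)
    have := hκ μ (Finset.mem_filter.1 hμ).1
    rw [abs_of_nonneg (by linarith [(Finset.mem_filter.1 hμ).2])] at this
    linarith
  · rcases S.eq_empty_or_nonempty with hSe | hSn
    · rw [hSe, Finset.prod_empty, map_one] at hann
      simpa using LinearMap.congr_fun hann v
    have hP0 : ∀ μ ∈ S, P μ v = 0 := by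
      rw [Seminorm.finsetSum_apply, Finset.sum_eq_zero_iff_of_nonneg fun μ _ => apply_nonneg _ _] at hv1 hv2
      intro μ hμ
      by_cases h : ‖μ‖ < 1
      · exact hv1 μ (Finset.mem_filter.2 ⟨hμ, h⟩)
      · exact hv2 μ (Finset.mem_filter.2 ⟨hμ, h⟩)
    have hg0 : ∀ μ ∈ S, g μ v = 0 := fun μ hμ =>
      hr _ (le_antisymm ((hP3 μ hμ v).trans (hP0 μ hμ).le) (apply_nonneg _ _))
    -- By Bézout, the products over all roots but one generate the unit ideal, so `v` is a
    -- combination of the vanishing `g μ v`.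
    have hcop : Pairwise (Function.onFun IsCoprime fun μ : S => s μ) := fun μ ν h =>
      (pairwise_coprime_X_sub_C (s := fun μ : S => (μ : ℂ)) Subtype.val_injective h).pow
    obtain ⟨c, hc⟩ := (exists_sum_eq_one_iff_pairwise_coprime hSn).2 hcop
    have h1 := LinearMap.congr_fun (congrArg (aeval f) hc) v
    rw [map_sum, map_one, LinearMap.sum_apply] at h1
    rw [Module.End.one_apply] at h1
    rw [← h1]
    refine Finset.sum_eq_zero fun μ hμ => ?_
    rw [map_mul, Module.End.mul_apply, show aeval f (∏ ν ∈ S \ {μ}, s ν) v = 0 from hg0 μ hμ,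
      map_zero]

theorem Seminorm.exists_le_mul_norm {E : Type*} [NormedAddCommGroup E] [NormedSpace ℝ E]
    [FiniteDimensional ℝ E] (p : Seminorm ℝ E) : ∃ C : ℝ, 0 < C ∧ ∀ v, p v ≤ C * ‖v‖ := by
  set b := Module.finBasis ℝ E
  let e : E →L[ℝ] (Fin (Module.finrank ℝ E) → ℝ) := LinearMap.toContinuousLinearMap b.equivFun
  refine ⟨∑ i, ‖e‖ * p (b i) + 1, add_pos_of_nonneg_of_pos
    (Finset.sum_nonneg fun i _ => mul_nonneg (norm_nonneg _) (apply_nonneg _ _)) one_pos,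
    fun v => ?_⟩
  have h1 : p v ≤ ∑ i, p (b.repr v i • b i) := by
    conv_lhs => rw [← b.sum_repr v]
    exact Finset.le_sum_of_subadditive p (map_zero p).le (map_add_le_add p) _ _
  refine h1.trans ?_
  rw [add_mul, Finset.sum_mul]
  refine le_add_of_le_of_nonneg (Finset.sum_le_sum fun i _ => ?_) (by positivity)
  rw [map_smul_eq_mul]
  have h2 : ‖b.repr v i‖ ≤ ‖e‖ * ‖v‖ := (norm_le_pi_norm (e v) i).trans (e.le_opNorm v)
  calc _ ≤ ‖e‖ * ‖v‖ * p (b i) := mul_le_mul_of_nonneg_right h2 (apply_nonneg _ _)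
    _ = _ := by ring

/-- A separating seminorm is continuous and has a positive minimum on the compact unit sphere; the
sphere is empty only if the space is zero. -/
theorem Seminorm.exists_norm_le_mul {E : Type*} [NormedAddCommGroup E] [NormedSpace ℝ E]
    [FiniteDimensional ℝ E] (p : Seminorm ℝ E) (hp : ∀ v, p v = 0 → v = 0) :
    ∃ C : ℝ, 0 < C ∧ ∀ v, ‖v‖ ≤ C * p v := by
  obtain ⟨C, hC, hpC⟩ := p.exists_le_mul_norm
  have hcont : Continuous p := (LipschitzWith.of_dist_le_mul (K := C.toNNReal) fun v w => by
    rw [Real.dist_eq, dist_eq_norm, Real.coe_toNNReal _ hC.le]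
    exact (abs_sub_map_le_sub p v w).trans (hpC _)).continuous
  rcases (Metric.sphere (0 : E) 1).eq_empty_or_nonempty with h | h
  · refine ⟨1, one_pos, fun v => ?_⟩
    by_cases hv : v = 0
    · simp [hv]
    · exact absurd (show ‖v‖⁻¹ • v ∈ Metric.sphere (0 : E) 1 by simp [norm_smul, hv])
        (h ▸ Set.notMem_empty _)
  · obtain ⟨w, hw, hmin⟩ := (isCompact_sphere (0 : E) 1).exists_isMinOn h hcont.continuousOn
    have hw0 : 0 < p w := (apply_nonneg p w).lt_of_ne' fun h0 => by
      simp [hp w h0] at hw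
    refine ⟨(p w)⁻¹, inv_pos.2 hw0, fun v => ?_⟩
    by_cases hv : v = 0
    · simp [hv]
    have hv' : 0 < ‖v‖ := norm_pos_iff.2 hv
    have h1 : p w ≤ p (‖v‖⁻¹ • v) := hmin (show ‖v‖⁻¹ • v ∈ Metric.sphere (0 : E) 1 by
      simp [norm_smul, hv])
    rw [map_smul_eq_mul, norm_inv, norm_norm, le_inv_mul_iff₀ hv'] at h1
    rw [le_inv_mul_iff₀ hw0]
    linarith

/-- An endomorphism of a finite-dimensional real normed space whose complexification has no
eigenvalue on the unit circle admits a contracted and an expanded seminorm whose sum is equivalent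
to the norm. -/
theorem exists_hyperbolic_seminorms {E : Type*} [NormedAddCommGroup E] [NormedSpace ℝ E]
    [FiniteDimensional ℝ E] (f : E →ₗ[ℝ] E)
    (hf : ∀ ρ : ℂ, Module.End.HasEigenvalue (LinearMap.baseChange ℂ f) ρ → ‖ρ‖ ≠ 1) :
    ∃ (κ C : ℝ) (p q : Seminorm ℝ E), 0 < κ ∧ κ ≤ 1 / 2 ∧ 0 < C ∧
      (∀ v, p (f v) ≤ (1 - 2 * κ) * p v) ∧ (∀ v, (1 + 2 * κ) * q v ≤ q (f v)) ∧
      (∀ v, p v ≤ C * ‖v‖) ∧ (∀ v, q v ≤ C * ‖v‖) ∧ ∀ v, ‖v‖ ≤ C * (p v + q v) := by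
  obtain ⟨κ, p, q, h0, h2, hp, hq, hpq⟩ := exists_hyperbolic_seminorms_complex _ hf
  -- Pulling back along `v ↦ 1 ⊗ v` keeps the estimates, since it intertwines `f` with its
  -- complexification, and keeps separation, since it is injective.
  let ι : E →ₗ[ℝ] TensorProduct ℝ ℂ E := TensorProduct.mk ℝ ℂ E 1
  have hι : Function.Injective ι :=
    Module.FaithfullyFlat.tensorProduct_mk_injective (A := ℝ) (B := ℂ) E
  have hfι : ∀ v, ι (f v) = LinearMap.baseChange ℂ f (ι v) := fun v => by simp [ι]
  let p' : Seminorm ℝ E := (p.restrictScalars ℝ).comp ι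
  let q' : Seminorm ℝ E := (q.restrictScalars ℝ).comp ι
  have hp' : ∀ v, p' v = p (ι v) := fun _ => rfl
  have hq' : ∀ v, q' v = q (ι v) := fun _ => rfl
  obtain ⟨C₁, hC₁, h₁⟩ := p'.exists_le_mul_norm
  obtain ⟨C₂, hC₂, h₂⟩ := q'.exists_le_mul_norm
  obtain ⟨C₃, hC₃, h₃⟩ := (p' + q').exists_norm_le_mul fun v hv => by
    rw [add_apply, add_eq_zero_iff_of_nonneg (apply_nonneg _ _) (apply_nonneg _ _)] at hv
    exact hι ((hpq (ι v) hv.1 hv.2).trans (map_zero ι).symm)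
  refine ⟨κ, C₁ + C₂ + C₃, p', q', h0, h2, by positivity, fun v => ?_, fun v => ?_, fun v => ?_,
    fun v => ?_, fun v => ?_⟩
  · rw [hp', hp', hfι]; exact hp _
  · rw [hq', hq', hfι]; exact hq _
  · exact (h₁ v).trans (mul_le_mul_of_nonneg_right (by linarith) (norm_nonneg _))
  · exact (h₂ v).trans (mul_le_mul_of_nonneg_right (by linarith) (norm_nonneg _))
  · exact (h₃ v).trans (mul_le_mul_of_nonneg_right (by linarith)
      (add_nonneg (apply_nonneg _ _) (apply_nonneg _ _)))

end HyperbolicSplitting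

/-! ### Exponential decay under small relative perturbations -/

section ExponentialDecay

variable {E : Type*} [NormedAddCommGroup E] [NormedSpace ℝ E]

/-- A bounded orbit of a small relative perturbation of a hyperbolic map decays geometrically. -/
theorem norm_le_geometric_of_hyperbolic (M : E →ₗ[ℝ] E) {κ C ε R : ℝ} {p q : Seminorm ℝ E}
    (hκ0 : 0 < κ) (hκ : κ ≤ 1 / 2) (hC : 0 < C)
    (hp : ∀ v, p (M v) ≤ (1 - 2 * κ) * p v) (hq : ∀ v, (1 + 2 * κ) * q v ≤ q (M v))
    (hpC : ∀ v, p v ≤ C * ‖v‖) (hqC : ∀ v, q v ≤ C * ‖v‖) (hpq : ∀ v, ‖v‖ ≤ C * (p v + q v))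
    (hε0 : 0 ≤ ε) (hε : C * (ε * C) ≤ κ / 2) {x : ℕ → E} (hR : ∀ n, ‖x n‖ ≤ R)
    (hx : ∀ n, ‖x (n + 1) - M (x n)‖ ≤ ε * ‖x n‖) :
    ∃ D, 0 ≤ D ∧ ∀ n, ‖x n‖ ≤ D * (1 - κ) ^ n := by
  have ha0 : ∀ n, 0 ≤ p (x n) := fun n => apply_nonneg _ _
  have hb0 : ∀ n, 0 ≤ q (x n) := fun n => apply_nonneg _ _
  have hrem : ∀ n, C * ‖x (n + 1) - M (x n)‖ ≤ κ / 2 * (p (x n) + q (x n)) := fun n =>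
    calc C * ‖x (n + 1) - M (x n)‖ ≤ C * (ε * (C * (p (x n) + q (x n)))) := by
          gcongr
          exact (hx n).trans (mul_le_mul_of_nonneg_left (hpq _) hε0)
      _ = C * (ε * C) * (p (x n) + q (x n)) := by ring
      _ ≤ _ := mul_le_mul_of_nonneg_right hε (add_nonneg (ha0 n) (hb0 n))
  have ha : ∀ n, p (x (n + 1)) ≤ (1 - 2 * κ) * p (x n) + κ / 2 * (p (x n) + q (x n)) := fun n => by
    have h1 := map_add_le_add p (M (x n)) (x (n + 1) - M (x n))
    rw [add_sub_cancel] at h1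
    linarith [hp (x n), (hpC (x (n + 1) - M (x n))).trans (hrem n)]
  have hb : ∀ n, (1 + 2 * κ) * q (x n) - κ / 2 * (p (x n) + q (x n)) ≤ q (x (n + 1)) := fun n => by
    have h1 := map_sub_le_add q (x (n + 1)) (x (n + 1) - M (x n))
    rw [sub_sub_cancel] at h1
    linarith [hq (x n), (hqC (x (n + 1) - M (x n))).trans (hrem n)]
  -- The cone `p ≤ q` is forward invariant: there the error is at most `κ q`, so `q` grows by `1 +
  -- κ` while the new `p` stays below the old `q`. Boundedness forces `q = 0`.
  have hcone : ∀ n, p (x n) ≤ q (x n) → q (x n) = 0 := fun n hn => by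
    have hgrow : ∀ k, p (x (n + k)) ≤ q (x (n + k)) ∧ (1 + κ) ^ k * q (x n) ≤ q (x (n + k)) := by
      intro k
      induction k with
      | zero => simpa using hn
      | succ k ih =>
        have h1 : (1 + κ) * q (x (n + k)) ≤ q (x (n + k + 1)) := by
          nlinarith [hb (n + k), ih.1]
        have h2 : p (x (n + k + 1)) ≤ q (x (n + k)) := by
          nlinarith [ha (n + k), ih.1, hb0 (n + k)]
        refine ⟨h2.trans (le_trans (by nlinarith [hb0 (n + k)]) h1), le_trans ?_ h1⟩
        rw [pow_succ']
        nlinarith [ih.2]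
    by_contra hne
    have hpos : 0 < q (x n) := (hb0 n).lt_of_ne' hne
    obtain ⟨k, hk⟩ := pow_unbounded_of_one_lt (C * R / q (x n)) (by linarith : 1 < 1 + κ)
    rw [div_lt_iff₀ hpos] at hk
    linarith [(hgrow k).2, hqC (x (n + k)), mul_le_mul_of_nonneg_left (hR (n + k)) hC.le]
  have hle : ∀ n, q (x n) ≤ p (x n) := fun n => by
    rcases le_total (p (x n)) (q (x n)) with h | h
    · rw [hcone n h]; exact ha0 n
    · exact h
  have hdecay : ∀ n, p (x n) ≤ p (x 0) * (1 - κ) ^ n := fun n => by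
    induction n with
    | zero => simp
    | succ n ih =>
      have h1 : p (x (n + 1)) ≤ (1 - κ) * p (x n) := by nlinarith [ha n, hle n]
      rw [pow_succ]
      nlinarith
  refine ⟨2 * C * p (x 0), by positivity, fun n => (hpq _).trans ?_⟩
  nlinarith [hle n, hdecay n]

/-- Solutions of a small relative perturbation of a hyperbolic periodic linear equation that
tend to zero do so exponentially fast. -/
theorem exists_exp_mul_norm_tendsto_zero [FiniteDimensional ℝ E] {B Φ : ℝ → E →L[ℝ] E} {K T : ℝ}
    (hT : 0 < T) (hBK : ∀ t, ‖B t‖ ≤ K) (hper : Function.Periodic B T) (h0 : Φ 0 = 1)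
    (hΦ : ∀ t, HasDerivAt Φ (B t * Φ t) t)
    (hyp : ∀ ρ : ℂ, Module.End.HasEigenvalue
      (LinearMap.baseChange ℂ (Φ T : E →ₗ[ℝ] E)) ρ → ‖ρ‖ ≠ 1)
    {x x' : ℝ → E} (hx : ∀ t, HasDerivAt x (x' t) t) (hlim : Tendsto x atTop (𝓝 0))
    (hpert : ∀ ε > 0, ∀ᶠ t in atTop, ‖x' t - B t (x t)‖ ≤ ε * ‖x t‖) :
    ∃ γ, 0 < γ ∧ Tendsto (fun t => Real.exp (γ * t) * ‖x t‖) atTop (𝓝 0) := by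
  -- Allows the division by `K` in the Gronwall bound to be dropped.
  wlog hK : 1 ≤ K generalizing K
  · exact this (K := 1) (fun t => (hBK t).trans (not_le.1 hK).le) le_rfl
  have hK0 : 0 < K := one_pos.trans_le hK
  obtain ⟨κ, C, p, q, hκ0, hκ, hC, hp, hq, hpC, hqC, hpq⟩ := exists_hyperbolic_seminorms _ hyp
  -- Growth of `‖x‖` over one period: `‖x'‖ ≤ (K + 1) ‖x‖` as soon as `ε ≤ 1`. The second bound on
  -- `ε` makes the one-period error `ε L exp (K T)` meet the smallness condition of the discrete
  -- lemma.
  set L := Real.exp ((K + 1) * T) with hL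
  have hL0 : 0 < L := Real.exp_pos _
  set ε := min 1 (κ / (2 * C ^ 2 * L * Real.exp (K * T))) with hε
  have hε0 : 0 < ε := by positivity
  have hε1 : ε ≤ 1 := min_le_left _ _
  obtain ⟨t₀, ht₀⟩ := eventually_atTop.1 (hpert ε hε0)
  have hxc : Continuous x := continuous_iff_continuousAt.2 fun t => (hx t).continuousAt
  have hgrow : ∀ s, t₀ ≤ s → ∀ t ∈ Set.Icc s (s + T), ‖x t‖ ≤ L * ‖x s‖ := fun s hs t ht => by
    have := norm_le_gronwallBound_of_norm_deriv_right_le (f := x) (f' := x') (δ := ‖x s‖)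
      (K := K + 1) (ε := 0) (a := s) (b := s + T) hxc.continuousOn
      (fun t _ => (hx t).hasDerivWithinAt) le_rfl (fun t ht => by
        have h1 := norm_sub_norm_le (x' t) (B t (x t))
        have h2 := (B t).le_of_opNorm_le (hBK t) (x t)
        have h3 := ht₀ t (hs.trans ht.1)
        nlinarith [norm_nonneg (x t)]) t ht
    rw [gronwallBound_ε0, mul_comm] at this
    refine this.trans (mul_le_mul_of_nonneg_right (Real.exp_le_exp.2 ?_) (norm_nonneg _))
    nlinarith [ht.2]
  have hstep : ∀ n : ℕ, t₀ ≤ n * T → ‖x (n * T + T) - Φ T (x (n * T))‖ ≤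
      ε * L * Real.exp (K * T) * ‖x (n * T)‖ := fun n hn => by
    -- Since `s` is a multiple of the period, `Φ (t - s) (x s)` solves the unperturbed equation; its
    -- difference from `x` vanishes at `s`.
    set s : ℝ := n * T with hs
    have hd : ∀ t, HasDerivAt (fun t => x t - Φ (t - s) (x s))
        (x' t - B t (Φ (t - s) (x s))) t := fun t => by
      have h1 : HasDerivAt (fun t => Φ (t - s)) (B t * Φ (t - s)) t := by
        have := (hΦ (t - s)).comp_sub_const t s
        rwa [hs, hper.sub_nat_mul_eq] at this
      simpa using (hx t).fun_sub (h1.clm_apply (hasDerivAt_const t (x s)))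
    have := norm_le_gronwallBound_of_norm_deriv_right_le (f := fun t => x t - Φ (t - s) (x s))
      (f' := fun t => x' t - B t (Φ (t - s) (x s))) (δ := 0) (K := K) (ε := ε * (L * ‖x s‖))
      (a := s) (b := s + T)
      (continuous_iff_continuousAt.2 fun t => (hd t).continuousAt).continuousOn
      (fun t _ => (hd t).hasDerivWithinAt) (by simp [h0]) (fun t ht => by
        have h1 : x' t - B t (Φ (t - s) (x s)) =
            B t (x t - Φ (t - s) (x s)) + (x' t - B t (x t)) := by rw [map_sub]; abel
        rw [h1]
        refine (norm_add_le _ _).trans (add_le_add ((B t).le_of_opNorm_le (hBK t) _) ?_)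
        refine (ht₀ t (hn.trans ht.1)).trans (mul_le_mul_of_nonneg_left ?_ hε0.le)
        exact hgrow s hn t ⟨ht.1, ht.2.le⟩) (s + T) ⟨by linarith, le_rfl⟩
    rw [gronwallBound_of_K_ne_0 hK0.ne'] at this
    simp only [add_sub_cancel_left, zero_mul, zero_add] at this
    refine this.trans ?_
    have h2 : ε * (L * ‖x s‖) / K ≤ ε * (L * ‖x s‖) := div_le_self (by positivity) hK
    calc _ ≤ ε * (L * ‖x s‖) * Real.exp (K * T) := by
          refine mul_le_mul h2 (by linarith) ?_ (by positivity)
          exact sub_nonneg.2 (Real.one_le_exp (by positivity))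
      _ = _ := by ring
  obtain ⟨n₀, hn₀⟩ := exists_nat_ge (t₀ / T)
  rw [div_le_iff₀ hT] at hn₀
  have hnT : ∀ n : ℕ, t₀ ≤ ((n₀ + n : ℕ) : ℝ) * T := fun n => hn₀.trans (by
    push_cast; nlinarith [n.cast_nonneg (α := ℝ)])
  have hylim : Tendsto (fun n : ℕ => x (((n₀ + n : ℕ) : ℝ) * T)) atTop (𝓝 0) := by
    refine hlim.comp (Tendsto.atTop_mul_const hT (tendsto_natCast_atTop_atTop.comp ?_))
    exact tendsto_atTop_mono (fun n => Nat.le_add_left n n₀) tendsto_id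
  obtain ⟨R, hR⟩ := (Metric.isBounded_range_of_tendsto _ hylim).exists_norm_le
  obtain ⟨D, hD0, hD⟩ := norm_le_geometric_of_hyperbolic (Φ T : E →ₗ[ℝ] E) hκ0 hκ hC hp hq hpC hqC
    hpq (ε := ε * L * Real.exp (K * T)) (by positivity) (by
      have h1 : ε ≤ κ / (2 * C ^ 2 * L * Real.exp (K * T)) := min_le_right _ _
      rw [le_div_iff₀ (by positivity)] at h1
      linarith) (x := fun n : ℕ => x (((n₀ + n : ℕ) : ℝ) * T))
      (fun n => hR _ (Set.mem_range_self n)) (fun n => by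
        have := hstep (n₀ + n) (hnT n)
        rwa [show ((n₀ + n : ℕ) : ℝ) * T + T = ((n₀ + (n + 1) : ℕ) : ℝ) * T by
          push_cast; ring] at this)
  have hσ : 0 < 1 - κ := by linarith
  -- Half the rate of the discrete decay; the other half leaves a factor `exp (-(γ t))`, so the
  -- product tends to zero.
  set γ := -Real.log (1 - κ) / (2 * T) with hγ
  have hγ0 : 0 < γ := div_pos (neg_pos.2 (Real.log_neg hσ (by linarith))) (by positivity)
  have hσγ : 1 - κ = Real.exp (-(2 * γ * T)) := by
    rw [show -(2 * γ * T) = Real.log (1 - κ) by rw [hγ]; field_simp, Real.exp_log hσ]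
  refine ⟨γ, hγ0, ?_⟩
  have hbound : ∀ᶠ t in atTop, Real.exp (γ * t) * ‖x t‖ ≤
      L * D * Real.exp (2 * γ * ((n₀ + 1) * T)) * Real.exp (-(γ * t)) := by
    filter_upwards [eventually_ge_atTop (n₀ * T)] with t ht
    obtain ⟨n, hn⟩ := Nat.exists_eq_add_of_le (Nat.le_floor ((le_div_iff₀ hT).2 ht))
    have h1 : ((n₀ + n : ℕ) : ℝ) * T ≤ t := by
      rw [← hn, ← le_div_iff₀ hT]
      exact Nat.floor_le (div_nonneg (le_trans (by positivity) ht) hT.le)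
    have h2 : t < (((n₀ + n : ℕ) : ℝ) + 1) * T := by
      rw [← hn, ← div_lt_iff₀ hT]
      exact Nat.lt_floor_add_one _
    have h3 := (hgrow _ (hnT n) t ⟨h1, by linarith⟩).trans
      (mul_le_mul_of_nonneg_left (hD n) hL0.le)
    have h4 : (1 - κ) ^ n ≤ Real.exp (2 * γ * ((n₀ + 1) * T) - 2 * γ * t) := by
      rw [hσγ, ← Real.exp_nat_mul]
      refine Real.exp_le_exp.2 ?_
      push_cast at h2
      nlinarith
    calc Real.exp (γ * t) * ‖x t‖
        ≤ Real.exp (γ * t) * (L * (D * Real.exp (2 * γ * ((n₀ + 1) * T) - 2 * γ * t))) := by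
          gcongr
          exact h3.trans (by gcongr)
      _ = L * D * (Real.exp (γ * t) * Real.exp (2 * γ * ((n₀ + 1) * T) - 2 * γ * t)) := by ring
      _ = L * D * (Real.exp (2 * γ * ((n₀ + 1) * T)) * Real.exp (-(γ * t))) := by
          rw [← Real.exp_add, ← Real.exp_add]; ring_nf
      _ = _ := by ring
  refine squeeze_zero' (Eventually.of_forall fun t => by positivity) hbound ?_
  rw [← mul_zero (L * D * Real.exp (2 * γ * ((n₀ + 1) * T)))]
  exact (Real.tendsto_exp_neg_atTop_nhds_zero.comp
    (tendsto_id.const_mul_atTop hγ0)).const_mul _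

end ExponentialDecay

/-! ### Application to the Hamiltonian system at both ends -/

section Homoclinic

variable {N : ℕ} {J : Matrix (Fin (2 * N)) (Fin (2 * N)) ℝ}

theorem IsSymplecticUnit.matAct_matAct (hJ : IsSymplecticUnit J) (v : Phase N) :
    matAct J (matAct J v) = -v := by
  have h1 : J * J = -1 := by
    have := hJ.2
    rw [hJ.1, mul_neg] at this
    rw [← this, neg_neg]
  have h2 : matAct J * matAct J = -1 := by
    rw [matAct, ← map_mul, h1, map_neg, map_one]
  simpa using congrArg (fun f : Phase N →L[ℝ] Phase N => f v) h2

theorem IsBundleMapC1.continuous_asympMatrix {g : ℝ → Phase N → ℝ → Phase N} {lam : ℝ}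
    (hg : IsBundleMapC1 fun t ξ => g t ξ lam) : Continuous (asympMatrix g lam) :=
  hg.2.2.1.comp (continuous_id.prodMk continuous_const)

theorem asympMatrix_periodic {g : ℝ → Phase N → ℝ → Phase N} {lam T : ℝ}
    (hper : ∀ t ξ, g (t + T) ξ lam = g t ξ lam) : Function.Periodic (asympMatrix g lam) T :=
  fun t => by simp only [asympMatrix, hper]

/-- Existence and properties of the fundamental solution of a periodic Hamiltonian system,
written in explicit form `u' = -J A(t) u`. -/
theorem exists_hyperbolic_fundamentalSolution (hJ : IsSymplecticUnit J)
    {A : ℝ → Phase N →L[ℝ] Phase N} {T : ℝ} (hT : 0 < T) (hA : Continuous A)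
    (hper : Function.Periodic A T) (hmul : NoUnitMultiplier J A T) :
    ∃ (K : ℝ) (Φ : ℝ → Phase N →L[ℝ] Phase N), (∀ t, ‖-(matAct J * A t)‖ ≤ K) ∧ Φ 0 = 1 ∧
      (∀ t, HasDerivAt Φ (-(matAct J * A t) * Φ t) t) ∧ ∀ ρ : ℂ, Module.End.HasEigenvalue
        (LinearMap.baseChange ℂ (Φ T : Phase N →ₗ[ℝ] Phase N)) ρ → ‖ρ‖ ≠ 1 := by
  have hB : Continuous fun t => -(matAct J * A t) := (continuous_const.mul hA).neg
  have hBper : Function.Periodic (fun t => -(matAct J * A t)) T := fun t => by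
    simp only [hper t]
  obtain ⟨K, hK⟩ := (hBper.isBounded_of_continuous hT.ne' hB).exists_norm_le
  have hK' : ∀ t, ‖-(matAct J * A t)‖ ≤ K := fun t => hK _ (Set.mem_range_self t)
  obtain ⟨Φ, h0, hΦ⟩ := exists_fundamentalSolution hB hK'
  refine ⟨K, Φ, hK', h0, hΦ, fun ρ hρ => hmul ρ ⟨Φ, ⟨h0, fun t => (hΦ t).differentiableAt,
    fun t => ?_⟩, hρ⟩⟩
  rw [(hΦ t).deriv]
  ext1 v
  simp [hJ.matAct_matAct]

/-- Serves the time reversal: inversion preserves the unit circle, so the inverse monodromy map is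
hyperbolic too. -/
theorem hasEigenvalue_inv_of_mul_eq_one {V : Type*} [AddCommGroup V] [Module ℂ V]
    {f g : Module.End ℂ V} (hgf : f * g = 1) {ρ : ℂ} (hρ : g.HasEigenvalue ρ) :
    f.HasEigenvalue ρ⁻¹ := by
  obtain ⟨v, hv⟩ := hρ.exists_hasEigenvector
  have h1 : ρ • f v = v := by
    rw [← map_smul, ← hv.apply_eq_smul, ← Module.End.mul_apply, hgf, Module.End.one_apply]
  have hρ0 : ρ ≠ 0 := by
    rintro rfl
    exact hv.2 (by rw [← h1, zero_smul])
  refine Module.End.hasEigenvalue_of_hasEigenvector (x := v) ⟨?_, hv.2⟩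
  rw [Module.End.mem_eigenspace_iff, ← inv_smul_smul₀ hρ0 (f v), h1]

/-- Along a curve tending to `0`, the gradient of `H` agrees with its asymptotic linearization
up to terms of smaller order. -/
theorem eventually_norm_gradH_sub_asympMatrix_le {H : ℝ → Phase N → ℝ → ℝ}
    {g : ℝ → Phase N → ℝ → Phase N} {lam : ℝ} {l : Filter ℝ} {x : ℝ → Phase N}
    (hH : ∀ t, Differentiable ℝ fun ξ => gradH H t ξ lam) (hH0 : ∀ t, gradH H t 0 lam = 0)
    (hg : IsBundleMapC1 fun t ξ => g t ξ lam)
    (hlim : ∀ S : Set (Phase N), Bornology.IsBounded S →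
      TendstoUniformlyOn (fun t ξ => hessH H t ξ lam - fderiv ℝ (fun η => g t η lam) ξ)
        (fun _ => 0) l S)
    (hx : Tendsto x l (𝓝 0)) {ε : ℝ} (hε : 0 < ε) :
    ∀ᶠ t in l, ‖gradH H t (x t) lam - asympMatrix g lam t (x t)‖ ≤ ε * ‖x t‖ := by
  -- Equicontinuity makes `δ` independent of `t`, so the derivative bound `ε` holds on one fixed
  -- ball containing both `0` and `x t` for all late `t`.
  obtain ⟨δ, hδ, hgδ⟩ := Metric.equicontinuousAt_iff.1 (hg.2.2.2 0) (ε / 2) (half_pos hε)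
  filter_upwards [Metric.tendstoUniformlyOn_iff.1 (hlim _ (Metric.isBounded_ball (x := 0) (r := δ)))
    (ε / 2) (half_pos hε), hx.eventually (Metric.ball_mem_nhds 0 hδ)] with t ht hxt
  have hd : ∀ ξ ∈ Metric.ball (0 : Phase N) δ, HasFDerivWithinAt
      (fun η => gradH H t η lam - asympMatrix g lam t η)
      (hessH H t ξ lam - asympMatrix g lam t) (Metric.ball 0 δ) ξ := fun ξ _ =>
    ((hH t ξ).hasFDerivAt.sub (asympMatrix g lam t).hasFDerivAt).hasFDerivWithinAt
  have hbound : ∀ ξ ∈ Metric.ball (0 : Phase N) δ,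
      ‖hessH H t ξ lam - asympMatrix g lam t‖ ≤ ε := fun ξ hξ => by
    have h1 := ht ξ hξ
    have h2 := hgδ ξ (Metric.mem_ball.1 hξ) t
    rw [dist_zero_left] at h1
    rw [dist_comm, dist_eq_norm] at h2
    have h3 := norm_add_le (hessH H t ξ lam - fderiv ℝ (fun η => g t η lam) ξ)
      (fderiv ℝ (fun η => g t η lam) ξ - asympMatrix g lam t)
    rw [sub_add_sub_cancel] at h3
    exact h3.trans ((add_le_add h1.le h2.le).trans (add_halves ε).le)
  have := (convex_ball (0 : Phase N) δ).norm_image_sub_le_of_norm_hasFDerivWithin_le hd hbound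
    (Metric.mem_ball_self hδ) hxt
  simpa [hH0] using this

theorem IsHomoclinicSolution.deriv_eq (hJ : IsSymplecticUnit J) {H : ℝ → Phase N → ℝ → ℝ}
    {lam : ℝ} {x : ℝ → Phase N} (hx : IsHomoclinicSolution J H lam x) (t : ℝ) :
    deriv x t = -matAct J (gradH H t (x t) lam) := by
  rw [← hx.equation, hJ.matAct_matAct, neg_neg]

theorem eventually_norm_matAct_le {l : Filter ℝ} {u v : ℝ → Phase N}
    (h : ∀ ε > 0, ∀ᶠ t in l, ‖u t‖ ≤ ε * ‖v t‖) {ε : ℝ} (hε : 0 < ε) :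
    ∀ᶠ t in l, ‖matAct J (u t)‖ ≤ ε * ‖v t‖ := by
  have hpos : 0 < ‖matAct J‖ + 1 := by positivity
  filter_upwards [h (ε / (‖matAct J‖ + 1)) (div_pos hε hpos)] with t ht
  calc ‖matAct J (u t)‖ ≤ ‖matAct J‖ * ‖u t‖ := (matAct J).le_opNorm _
    _ ≤ (‖matAct J‖ + 1) * (ε / (‖matAct J‖ + 1) * ‖v t‖) := by
        gcongr
        linarith
    _ = ε * ‖v t‖ := by field_simp

theorem IsHomoclinicSolution.exists_exp_decay_atTop (hJ : IsSymplecticUnit J)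
    {H : ℝ → Phase N → ℝ → ℝ} {g : ℝ → Phase N → ℝ → Phase N} {lam T : ℝ} {x : ℝ → Phase N}
    (hx : IsHomoclinicSolution J H lam x)
    (hH : ∀ t, Differentiable ℝ fun ξ => gradH H t ξ lam) (hH0 : ∀ t, gradH H t 0 lam = 0)
    (hg : IsBundleMapC1 fun t ξ => g t ξ lam) (hT : 0 < T)
    (hper : ∀ t ξ, g (t + T) ξ lam = g t ξ lam)
    (hlim : ∀ S : Set (Phase N), Bornology.IsBounded S →
      TendstoUniformlyOn (fun t ξ => hessH H t ξ lam - fderiv ℝ (fun η => g t η lam) ξ)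
        (fun _ => 0) atTop S)
    (hmul : NoUnitMultiplier J (asympMatrix g lam) T) :
    ∃ γ, 0 < γ ∧ Tendsto (fun t => Real.exp (γ * t) * ‖x t‖) atTop (𝓝 0) := by
  have hAper := asympMatrix_periodic hper
  obtain ⟨K, Φ, hK, h0, hΦ, hyp⟩ :=
    exists_hyperbolic_fundamentalSolution hJ hT hg.continuous_asympMatrix hAper hmul
  refine exists_exp_mul_norm_tendsto_zero hT hK (fun t => by simp only [hAper t]) h0 hΦ hyp
    (fun t => (hx.differentiable t).hasDerivAt) hx.lim_atTop fun ε hε => ?_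
  filter_upwards [eventually_norm_matAct_le (J := J) (fun ε hε =>
    eventually_norm_gradH_sub_asympMatrix_le hH hH0 hg hlim hx.lim_atTop hε) hε] with t ht
  rw [map_sub, norm_sub_rev] at ht
  rw [hx.deriv_eq hJ]
  have heq : -matAct J (gradH H t (x t) lam) - (-(matAct J * asympMatrix g lam t)) (x t) =
      matAct J (asympMatrix g lam t (x t)) - matAct J (gradH H t (x t) lam) := by
    rw [neg_apply, sub_neg_eq_add, neg_add_eq_sub]
    rfl
  rwa [heq]

/-- The reversed curve `x (-t)` is a perturbed solution for the coefficient `J A(-t)`, whose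
fundamental solution is `Φ (-t)` and whose monodromy map `Φ (-T)` is inverse to `Φ T`. -/
theorem IsHomoclinicSolution.exists_exp_decay_atBot (hJ : IsSymplecticUnit J)
    {H : ℝ → Phase N → ℝ → ℝ} {g : ℝ → Phase N → ℝ → Phase N} {lam T : ℝ} {x : ℝ → Phase N}
    (hx : IsHomoclinicSolution J H lam x)
    (hH : ∀ t, Differentiable ℝ fun ξ => gradH H t ξ lam) (hH0 : ∀ t, gradH H t 0 lam = 0)
    (hg : IsBundleMapC1 fun t ξ => g t ξ lam) (hT : 0 < T)
    (hper : ∀ t ξ, g (t + T) ξ lam = g t ξ lam)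
    (hlim : ∀ S : Set (Phase N), Bornology.IsBounded S →
      TendstoUniformlyOn (fun t ξ => hessH H t ξ lam - fderiv ℝ (fun η => g t η lam) ξ)
        (fun _ => 0) atBot S)
    (hmul : NoUnitMultiplier J (asympMatrix g lam) T) :
    ∃ γ, 0 < γ ∧ Tendsto (fun t => Real.exp (γ * t) * ‖x (-t)‖) atTop (𝓝 0) := by
  have hAper := asympMatrix_periodic hper
  obtain ⟨K, Φ, hK, h0, hΦ, hyp⟩ :=
    exists_hyperbolic_fundamentalSolution hJ hT hg.continuous_asympMatrix hAper hmul
  have hinv : Φ T * Φ (-T) = 1 := by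
    have hneg := fundamentalSolution_add_period hK (T := -T)
      (fun t => by simp only [hAper.neg t]) h0 hΦ T
    rw [← hneg, add_neg_cancel, h0]
  refine exists_exp_mul_norm_tendsto_zero (B := fun t => matAct J * asympMatrix g lam (-t))
    (Φ := fun t => Φ (-t)) (x' := fun t => -deriv x (-t)) hT
    (fun t => by simpa using hK (-t)) (fun t => ?_) (by simpa using h0) (fun t => ?_)
    (fun ρ hρ hρ1 => ?_) (fun t => ?_) (hx.lim_atBot.comp tendsto_neg_atTop_atBot)
    fun ε hε => ?_
  · simp only [neg_add, hAper.neg (-t)]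
  · have := (hΦ (-t)).scomp t (hasDerivAt_neg t)
    refine this.congr_deriv (ContinuousLinearMap.ext fun v => ?_)
    simp
  · refine hyp ρ⁻¹ (hasEigenvalue_inv_of_mul_eq_one ?_ hρ) (by simp [hρ1])
    rw [← LinearMap.baseChange_mul, ← ContinuousLinearMap.toLinearMap_mul, hinv]
    exact LinearMap.baseChange_id
  · have := (hx.differentiable (-t)).hasDerivAt.scomp t (hasDerivAt_neg t)
    simpa [Function.comp_def] using this
  · have := tendsto_neg_atTop_atBot.eventually (eventually_norm_matAct_le (J := J) (fun ε hε =>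
      eventually_norm_gradH_sub_asympMatrix_le hH hH0 hg hlim hx.lim_atBot hε) hε)
    filter_upwards [this] with t ht
    rw [map_sub] at ht
    rw [hx.deriv_eq hJ, neg_neg]
    exact ht

theorem tendsto_exp_mul_mono {γ γ' : ℝ} (h : γ ≤ γ') {u : ℝ → ℝ} (hu : ∀ t, 0 ≤ u t)
    (hlim : Tendsto (fun t => Real.exp (γ' * t) * u t) atTop (𝓝 0)) :
    Tendsto (fun t => Real.exp (γ * |t|) * u t) atTop (𝓝 0) := by
  refine squeeze_zero' (Eventually.of_forall fun t => mul_nonneg (Real.exp_pos _).le (hu t))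
    ?_ hlim
  filter_upwards [eventually_ge_atTop 0] with t ht
  rw [abs_of_nonneg ht]
  exact mul_le_mul_of_nonneg_right (Real.exp_le_exp.2 (mul_le_mul_of_nonneg_right h ht)) (hu t)

end Homoclinic

theorem theorem5p6 {N : ℕ} (J : Matrix (Fin (2 * N)) (Fin (2 * N)) ℝ)
    (hJ : IsSymplecticUnit J)
    (H : ℝ → Phase N → ℝ → ℝ)
    (h1 : HypH1 H) (h2 : HypH2 H) (h3 : HypH3 H) (h4 : HypH4 H)
    (gp gm : ℝ → Phase N → ℝ → Phase N) (Tp Tm : ℝ → ℝ)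
    (hInf : HypHInf H gp gm Tp Tm)
    (lam : ℝ)
    (hp : NoUnitMultiplier J (asympMatrix gp lam) (Tp lam))
    (hm : NoUnitMultiplier J (asympMatrix gm lam) (Tm lam))
    (x : ℝ → Phase N) (hx : IsHomoclinicSolution J H lam x) :
    ∃ γ : ℝ, 0 < γ ∧
      Tendsto (fun t : ℝ => Real.exp (γ * |t|) * ‖x t‖) (atBot ⊔ atTop) (𝓝 0) := by
  have hH : ∀ t, Differentiable ℝ fun ξ => gradH H t ξ lam := fun t => h2.hess_exists t lam
  have hH0 : ∀ t, gradH H t 0 lam = 0 := fun t => h1.grad_zero t lam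
  obtain ⟨γ₁, hγ₁, hlim₁⟩ := hx.exists_exp_decay_atTop hJ hH hH0 (hInf.bundle_p lam)
    (hInf.period_p_pos lam) (fun t ξ => hInf.periodic_p t ξ lam) (hInf.lim_p lam) hp
  obtain ⟨γ₂, hγ₂, hlim₂⟩ := hx.exists_exp_decay_atBot hJ hH hH0 (hInf.bundle_m lam)
    (hInf.period_m_pos lam) (fun t ξ => hInf.periodic_m t ξ lam) (hInf.lim_m lam) hm
  refine ⟨min γ₁ γ₂, lt_min hγ₁ hγ₂, Tendsto.sup ?_ ?_⟩
  · have := (tendsto_exp_mul_mono (min_le_right γ₁ γ₂) (fun t => norm_nonneg _) hlim₂).comp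
      tendsto_neg_atBot_atTop
    simpa [Function.comp_def] using this
  · exact tendsto_exp_mul_mono (min_le_left γ₁ γ₂) (fun t => norm_nonneg _) hlim₁
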